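/- Let $d\ge 1$ and $m\ge 1$ be integers, and let $L_m$ be the Dirichlet $L$-function of the principal character modulo $m$, that is, the meromorphic continuation to $\mathbb C$ of $\sum_{n\ge 1,\ \gcd(n,m)=1} n^{-s}$, whose only pole is at $s=1$. Put $$\sigma_0(L_m)=\sup\{\sigma\in\mathbb R:\ \operatorname{Re}L_m(\sigma+it)=0\text{ for some }t\in\mathbb R,\ \sigma+it\ne 1\}.$$ Let $g=g_1+ig_2:\mathbb R^d\to\mathbb C$ be bounded and continuous, with $g_1,g_2$ real-valued, and set $I_j=\inf g_j$, $S_j=\sup g_j$ for $j=1,2$. Assume $$I_1>\max\{1,\sigma_0(L_m)\}.$$ For $T>0$, a Duhamel solution on $[0,T]$ of the problem $$\partial_t u=\Delta u+L_m(u),\qquad u(0,\cdot)=g,$$ is a bounded continuous function $u=u_1+iu_2:[0,T]\times\mathbb R^d\to\mathbb C$, with $u_1,u_2$ real-valued, such that $\inf_{[0,T]\times\mathbb R^d}(|u_1-1|+|u_2|)>0$, the map $t\mapsto u(t,\cdot)$ is continuous from $(0,T]$ to the bounded continuous functions with the supremum norm, $u(0,\cdot)=g$, and for all $0<t\le T$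 $$u(t)=e^{t\Delta}g+\int_0^t e^{(t-s)\Delta}L_m(u(s))\,ds,\qquad e^{t\Delta}h=K_t*h,\quad K_t(x)=(4\pi t)^{-d/2}e^{-|x|^2/(4t)}.$$ Then there is a function $u=u_1+iu_2:[0,\infty)\times\mathbb R^d\to\mathbb C$ whose restriction to $[0,T]\times\mathbb R^d$ is a Duhamel solution on $[0,T]$ for every $T>0$, and every Duhamel solution on some $[0,T]$ coincides with $u$ on $[0,T]\times\mathbb R^d$; in other words, the local solution is unique and global. If $g$ is uniformly continuous, then $t\mapsto u(t,\cdot)$ is continuous in the supremum norm on all of $[0,\infty)$. Moreover, for all $t\ge 0$ and $x\in\mathbb R^d$, $$\max\{0,2-\zeta(I_1)\}\,t+I_1\le u_1(t,x)\le \zeta(I_1)\,t+S_1,$$ $$(1-\zeta(I_1))\,t+I_2\le u_2(t,x)\le(\zeta(I_1)-1)\,t+S_2,$$ where $\zeta$ is the Riemann zeta function. -/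

import Mathlib

open Set MeasureTheory BoundedContinuousFunction

/-- Van de Lune's abscissa `σ₀(L)` of the `L`-function of a Dirichlet character `χ`: the supremum
(in the extended reals) of all real `σ` such that `Re L(σ + it) = 0` for some real `t`.
The point `s = 1`, a pole of `L`, is disregarded when `χ` is principal. -/
noncomputable def vanDeLuneAbscissa {m : ℕ} [NeZero m] (χ : DirichletCharacter ℂ m) : EReal :=
  sSup ((fun σ : ℝ => (σ : EReal)) '' {σ : ℝ | ∃ t : ℝ,
    (χ ≠ 1 ∨ (σ : ℂ) + t * Complex.I ≠ 1) ∧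
      (DirichletCharacter.LFunction χ ((σ : ℂ) + t * Complex.I)).re = 0})

/-- The heat kernel `K_t(x) = (4πt)^(-d/2) exp(-|x|²/(4t))` on `ℝᵈ` (used for `t > 0`). -/
noncomputable def heatKernel {d : ℕ} (t : ℝ) (x : EuclideanSpace ℝ (Fin d)) : ℝ :=
  (4 * Real.pi * t) ^ (-(d : ℝ) / 2) * Real.exp (-‖x‖ ^ 2 / (4 * t))

/-- The heat semigroup `e^{tΔ} h = K_t ∗ h` for `t > 0`. -/
noncomputable def heatSemigroup {d : ℕ} (t : ℝ) (h : EuclideanSpace ℝ (Fin d) → ℂ)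
    (x : EuclideanSpace ℝ (Fin d)) : ℂ :=
  ∫ y, (heatKernel t (x - y) : ℂ) * h y

/-- `u` is a bounded continuous solution on `[0, T] × ℝᵈ`, in the Duhamel sense, of
`∂ₜ u = Δ u + L(u)`, `u(0) = g`, where `L` is the `L`-function of the principal character
modulo `m`. The solution has to stay at a positive distance from the pole `s = 1` of `L`. -/
structure IsDuhamelSolution {d : ℕ} (m : ℕ) [NeZero m]
    (g : EuclideanSpace ℝ (Fin d) →ᵇ ℂ) (T : ℝ)
    (u : ℝ → (EuclideanSpace ℝ (Fin d) →ᵇ ℂ)) : Prop where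
  /-- `u` is continuous in the supremum norm for positive times. -/
  continuousOn_norm : ContinuousOn u (Ioc 0 T)
  /-- `u` is jointly continuous up to the initial time. -/
  continuousOn_joint : ContinuousOn
    (fun p : ℝ × EuclideanSpace ℝ (Fin d) => u p.1 p.2) (Icc 0 T ×ˢ univ)
  /-- `u` is bounded on `[0, T] × ℝᵈ`. -/
  bounded : ∃ β : ℝ, ∀ t ∈ Icc 0 T, ‖u t‖ ≤ β
  /-- `u` stays away from the pole on `[0, T] × ℝᵈ`. -/
  away_from_pole : ∃ ε > 0, ∀ t ∈ Icc 0 T, ∀ x, ε ≤ |(u t x).re - 1| + |(u t x).im|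
  /-- The initial condition. -/
  initial : u 0 = g
  /-- Duhamel's formula. -/
  duhamel : ∀ t ∈ Ioc 0 T, ∀ x, u t x = heatSemigroup t g x +
    ∫ s in (0 : ℝ)..t, heatSemigroup (t - s)
      (fun y => DirichletCharacter.LFunction (1 : DirichletCharacter ℂ m) (u s y)) x

/-! On the half-plane `Re z ≥ I₁` the function `L_m` is Lipschitz (Cauchy estimates), satisfies
`|L_m - 1| ≤ ζ(I₁) - 1` (compare Dirichlet series) and has positive real part (`re_LFunction_pos`).
Composing it with the retraction `clampRe` onto this half-plane gives a bounded, globally Lipschitz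
reaction term `F`, for which Banach's fixed point theorem in an exponentially weighted sup norm
yields a global mild solution (`exists_mild_solution`).

The heat semigroup averages against a probability measure, so it preserves lower bounds of
real-linear functionals (`le_heatAverage`, `mul_le_duhamelIntegral`). Since `Re F > 0`, the solution
keeps `Re u ≥ I₁`; the retraction is never felt and `u` solves the original equation. The
functionals `±Re` and `±Im` give the four stated bounds in the same way.

For uniqueness, two solutions take values in a common compact set that misses the pole; `L_m` is
Lipschitz there and a Gronwall iteration applies (`IsDuhamelSolution.eqOn`). Norm continuity in time
follows from an `L¹` estimate for differences of heat kernels. -/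

/-! ### The principal `L`-function to the right of its pole -/

theorem LSeries_eq_one_add_tsum {a : ℕ → ℂ} {z : ℂ} (h : LSeriesSummable a z) (h1 : a 1 = 1) :
    LSeries a z = 1 + ∑' n, LSeries.term a z (n + 2) := by
  rw [LSeries, ← h.sum_add_tsum_nat_add 2]
  simp [Finset.sum_range_succ, LSeries.term_def, h1]

theorem re_LSeries_term_one (x : ℝ) (n : ℕ) :
    (LSeries.term 1 (x : ℂ) n).re = ‖LSeries.term 1 (x : ℂ) n‖ := by
  rcases Nat.eq_zero_or_pos n with rfl | hn
  · simp
  · have hn' : (0 : ℝ) ≤ n := n.cast_nonneg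
    have : LSeries.term 1 (x : ℂ) n = (((1 : ℝ) / (n : ℝ) ^ x : ℝ) : ℂ) := by
      rw [LSeries.term_of_ne_zero hn.ne']
      push_cast [Complex.ofReal_cpow hn']
      simp
    rw [this, Complex.ofReal_re, Complex.norm_real, Real.norm_of_nonneg (by positivity)]

theorem re_riemannZeta_eq {x : ℝ} (hx : 1 < x) :
    (riemannZeta (x : ℂ)).re = 1 + ∑' n, ‖LSeries.term 1 (x : ℂ) (n + 2)‖ := by
  have hx' : 1 < (x : ℂ).re := by simpa
  have hs : LSeriesSummable 1 (x : ℂ) := LSeriesSummable_one_iff.2 hx'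
  have hs2 : Summable fun n => LSeries.term 1 (x : ℂ) (n + 2) := (summable_nat_add_iff 2).2 hs
  rw [← LSeries_one_eq_riemannZeta hx', LSeries_eq_one_add_tsum hs rfl, Complex.add_re,
    Complex.re_tsum hs2]
  simp only [Complex.one_re, re_LSeries_term_one]

/-- The terms with `n = 1` are both `1`. The others are compared one by one: the coefficients have
modulus at most `1`, and `n^(-Re z) ≤ n^(-x)`. -/
theorem norm_LFunction_sub_one_le (m : ℕ) [NeZero m] {x : ℝ} (hx : 1 < x) {z : ℂ}
    (hz : x ≤ z.re) :
    ‖DirichletCharacter.LFunction (1 : DirichletCharacter ℂ m) z - 1‖ ≤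
      (riemannZeta (x : ℂ)).re - 1 := by
  have hz1 : 1 < z.re := hx.trans_le hz
  have hx' : 1 < (x : ℂ).re := by simpa
  have hs : LSeriesSummable (fun n => (1 : DirichletCharacter ℂ m) n) z :=
    DirichletCharacter.LSeriesSummable_of_one_lt_re _ hz1
  have hsx : LSeriesSummable 1 (x : ℂ) := LSeriesSummable_one_iff.2 hx'
  rw [DirichletCharacter.LFunction_eq_LSeries _ hz1, LSeries_eq_one_add_tsum hs (by simp),
    re_riemannZeta_eq hx, add_sub_cancel_left, add_sub_cancel_left]
  refine tsum_of_norm_bounded ((summable_nat_add_iff 2).2 hsx.norm).hasSum fun n => ?_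
  refine (LSeries.norm_term_le_of_re_le_re _ (s := x) (by simpa) (n + 2)).trans ?_
  exact LSeries.norm_term_le _ (by simpa using DirichletCharacter.norm_le_one _ _)

/-- Hence `|L_m - 1| < 1` on `Re z ≥ 2`, which fixes the sign of `Re L_m` there. -/
theorem re_riemannZeta_two_lt : (riemannZeta ((2 : ℝ) : ℂ)).re < 2 := by
  have : (riemannZeta ((2 : ℝ) : ℂ)) = ((Real.pi ^ 2 / 6 : ℝ) : ℂ) := by
    push_cast
    exact riemannZeta_two
  rw [this, Complex.ofReal_re]
  nlinarith [Real.pi_lt_d2, Real.pi_pos]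

theorem differentiableAt_LFunction_of_one_lt_re (m : ℕ) [NeZero m] {z : ℂ} (hz : 1 < z.re) :
    DifferentiableAt ℂ (DirichletCharacter.LFunction (1 : DirichletCharacter ℂ m)) z := by
  refine DirichletCharacter.differentiableAt_LFunction _ _ (Or.inl ?_)
  rintro rfl
  simp at hz

/-- By definition of the abscissa, `Re L_m` has no zero on the connected set `Re z ≥ a`, and it is
positive at `max a 2`; the intermediate value theorem excludes other signs. -/
theorem re_LFunction_pos (m : ℕ) [NeZero m] {a : ℝ}
    (ha : max 1 (vanDeLuneAbscissa (1 : DirichletCharacter ℂ m)) < (a : EReal)) {z : ℂ}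
    (hz : a ≤ z.re) :
    0 < (DirichletCharacter.LFunction (1 : DirichletCharacter ℂ m) z).re := by
  obtain ⟨h1, h2⟩ := max_lt_iff.1 ha
  have h1 : 1 < a := by exact_mod_cast h1
  set Lm := DirichletCharacter.LFunction (1 : DirichletCharacter ℂ m)
  have hne : ∀ w : ℂ, a ≤ w.re → (Lm w).re ≠ 0 := by
    intro w hw h0
    refine absurd (le_sSup ?_) (not_le.2 (h2.trans_le (EReal.coe_le_coe_iff.2 hw)))
    refine ⟨w.re, ⟨w.im, Or.inr ?_, ?_⟩, rfl⟩
    · rw [Complex.re_add_im]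
      rintro rfl
      simp at hw
      linarith
    · rwa [Complex.re_add_im]
  have hcont : ContinuousOn (fun w => (Lm w).re) {w : ℂ | a ≤ w.re} := fun w hw =>
    (Complex.continuous_re.continuousAt.comp
      (differentiableAt_LFunction_of_one_lt_re m
        (h1.trans_le hw)).continuousAt).continuousWithinAt
  have hconn : IsPreconnected {w : ℂ | a ≤ w.re} := (convex_halfSpace_re_ge a).isPreconnected
  have hfar : 0 < (Lm (max a 2 : ℝ)).re := by
    have := norm_LFunction_sub_one_le m one_lt_two (z := ((max a 2 : ℝ) : ℂ)) (by simp)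
    have h3 := (Complex.abs_re_le_norm _).trans this
    rw [Complex.sub_re, Complex.one_re] at h3
    linarith [(abs_le.1 h3).1, re_riemannZeta_two_lt]
  by_contra hcon
  obtain ⟨w, hw, hw0⟩ := hconn.intermediate_value (a := z) (b := ((max a 2 : ℝ) : ℂ)) hz
    (by simp) hcont ⟨not_lt.1 hcon, hfar.le⟩
  exact hne w hw hw0

/-- Discs of radius `r = (a - 1) / 2` around points of the half-plane stay in `Re ≥ b > 1`, where
`|L_m| ≤ ζ(b)`. Cauchy's estimate bounds the derivative by `ζ(b) / r`, and the half-plane is convex.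
-/
theorem exists_lipschitzOnWith_LFunction (m : ℕ) [NeZero m] {a : ℝ} (ha : 1 < a) :
    ∃ C, LipschitzOnWith C (DirichletCharacter.LFunction (1 : DirichletCharacter ℂ m))
      {z : ℂ | a ≤ z.re} := by
  set b : ℝ := (1 + a) / 2
  set r : ℝ := (a - 1) / 2
  have hb : 1 < b := by simp only [b]; linarith
  have hr : 0 < r := by simp only [r]; linarith
  set M : ℝ := (riemannZeta (b : ℂ)).re
  refine ⟨(M / r).toNNReal, Convex.lipschitzOnWith_of_nnnorm_deriv_le (fun z hz =>
    differentiableAt_LFunction_of_one_lt_re m (ha.trans_le hz)) (fun z hz => ?_)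
    (convex_halfSpace_re_ge a)⟩
  have key : ∀ w ∈ Metric.closedBall z r, b ≤ w.re := by
    intro w hw
    have h1 := (Complex.abs_re_le_norm (w - z)).trans (mem_closedBall_iff_norm.1 hw)
    rw [Complex.sub_re] at h1
    have h2 := (abs_le.1 h1).1
    have h3 : a ≤ z.re := hz
    simp only [b, r] at *
    linarith
  have := Complex.norm_deriv_le_of_forall_mem_sphere_norm_le (c := z) (C := M) hr
    (f := DirichletCharacter.LFunction (1 : DirichletCharacter ℂ m)) ?_ ?_
  · rw [← NNReal.coe_le_coe, coe_nnnorm]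
    exact this.trans (Real.le_coe_toNNReal _)
  · refine DifferentiableOn.diffContOnCl fun w hw => ?_
    rw [closure_ball z hr.ne'] at hw
    exact (differentiableAt_LFunction_of_one_lt_re m
      (hb.trans_le (key w hw))).differentiableWithinAt
  · intro w hw
    have h1 := norm_LFunction_sub_one_le m hb (key w (Metric.sphere_subset_closedBall hw))
    have h2 := norm_add_le (DirichletCharacter.LFunction (1 : DirichletCharacter ℂ m) w - 1) 1
    rw [sub_add_cancel, norm_one] at h2
    simp only [M]
    linarith

/-- Away from its pole, the principal `L`-function is bounded and Lipschitz on compact sets. -/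
theorem exists_lipschitzOnWith_LFunction_of_isCompact (m : ℕ) [NeZero m] {K : Set ℂ}
    (hK : IsCompact K) (h1 : 1 ∉ K) :
    ∃ C, LipschitzOnWith C (DirichletCharacter.LFunction (1 : DirichletCharacter ℂ m)) K := by
  -- `K` need not be convex, so a derivative bound would not suffice; compactness passes from local
  -- to global.
  refine LocallyLipschitzOn.exists_lipschitzOnWith_of_compact hK fun z hz => ?_
  have hd : DifferentiableOn ℂ (DirichletCharacter.LFunction (1 : DirichletCharacter ℂ m))
      {1}ᶜ := fun w hw => (DirichletCharacter.differentiableAt_LFunction _ _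
        (Or.inl hw)).differentiableWithinAt
  have hz1 : z ∈ ({1}ᶜ : Set ℂ) := fun h => h1 (h ▸ hz)
  have hc : ContDiffAt ℂ 1 (DirichletCharacter.LFunction (1 : DirichletCharacter ℂ m)) z :=
    (hd.analyticAt (isOpen_compl_singleton.mem_nhds hz1)).contDiffAt
  obtain ⟨C, t, ht, hC⟩ := hc.exists_lipschitzOnWith
  exact ⟨C, t, mem_nhdsWithin_of_mem_nhds ht, hC⟩

/-! ### The heat kernel -/

section HeatKernel

variable {d : ℕ}

theorem heatKernel_nonneg {t : ℝ} (ht : 0 ≤ t) (x : EuclideanSpace ℝ (Fin d)) :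
    0 ≤ heatKernel t x := by
  unfold heatKernel
  positivity

theorem continuous_heatKernel (t : ℝ) :
    Continuous (heatKernel t : EuclideanSpace ℝ (Fin d) → ℝ) := by
  unfold heatKernel
  fun_prop

theorem heatKernel_neg (t : ℝ) (x : EuclideanSpace ℝ (Fin d)) :
    heatKernel t (-x) = heatKernel t x := by
  simp [heatKernel]

theorem integral_heatKernel {t : ℝ} (ht : 0 < t) :
    ∫ x : EuclideanSpace ℝ (Fin d), heatKernel t x = 1 := by
  have h := GaussianFourier.integral_rexp_neg_mul_sq_norm (V := EuclideanSpace ℝ (Fin d))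
    (b := 1 / (4 * t)) (by positivity)
  have h' : ∀ x : EuclideanSpace ℝ (Fin d), heatKernel t x =
      (4 * Real.pi * t) ^ (-(d : ℝ) / 2) * Real.exp (-(1 / (4 * t)) * ‖x‖ ^ 2) := by
    intro x
    unfold heatKernel
    congr 2
    ring
  simp_rw [h']
  rw [integral_const_mul, h, finrank_euclideanSpace_fin,
    show Real.pi / (1 / (4 * t)) = 4 * Real.pi * t by field_simp,
    ← Real.rpow_add (by positivity), neg_div, neg_add_cancel, Real.rpow_zero]

theorem integrable_heatKernel {t : ℝ} (ht : 0 < t) :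
    Integrable (heatKernel t : EuclideanSpace ℝ (Fin d) → ℝ) :=
  Integrable.of_integral_ne_zero (by rw [integral_heatKernel ht]; exact one_ne_zero)

theorem heatKernel_smul {t : ℝ} (ht : 0 < t) (x : EuclideanSpace ℝ (Fin d)) :
    heatKernel t (√t • x) = (√t ^ d)⁻¹ * heatKernel 1 x := by
  have hs : √t ^ d = t ^ ((d : ℝ) / 2) := by
    rw [Real.sqrt_eq_rpow, ← Real.rpow_natCast, ← Real.rpow_mul ht.le]
    congr 1
    ring
  have he : -(√t * ‖x‖) ^ 2 / (4 * t) = -‖x‖ ^ 2 / (4 * 1) := by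
    rw [mul_pow, Real.sq_sqrt ht.le]
    field_simp
  unfold heatKernel
  rw [norm_smul, Real.norm_of_nonneg (Real.sqrt_nonneg t), he, hs, ← Real.rpow_neg ht.le,
    Real.mul_rpow (by positivity) ht.le, neg_div 2 (d : ℝ)]
  simp only [mul_one]
  ring

/-- The exponential factor grows with time, so only the prefactor is lost. This pointwise domination
reduces the `L¹` distance of two kernels to their masses. -/
theorem rpow_mul_heatKernel_le {s t : ℝ} (ht : 0 < t) (hts : t ≤ s)
    (x : EuclideanSpace ℝ (Fin d)) :
    (t / s) ^ ((d : ℝ) / 2) * heatKernel t x ≤ heatKernel s x := by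
  have hs : 0 < s := ht.trans_le hts
  have he : Real.exp (-‖x‖ ^ 2 / (4 * t)) ≤ Real.exp (-‖x‖ ^ 2 / (4 * s)) := by
    rw [Real.exp_le_exp, neg_div, neg_div, neg_le_neg_iff]
    gcongr
  have hc : (t / s) ^ ((d : ℝ) / 2) * (4 * Real.pi * t) ^ (-(d : ℝ) / 2) =
      (4 * Real.pi * s) ^ (-(d : ℝ) / 2) := by
    rw [neg_div, Real.rpow_neg (by positivity), Real.rpow_neg (by positivity), ← div_eq_mul_inv,
      ← Real.div_rpow (by positivity) (by positivity), ← Real.inv_rpow (by positivity)]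
    congr 1
    field_simp
  unfold heatKernel
  rw [← mul_assoc, hc]
  gcongr

/-- Bernoulli's inequality with exponent `d` in place of `d / 2`, then `q² / (1 + q²) ≤ q` for `q² =
(s - t) / t`. The square root matters: `(t - r)^(-1/2)` is integrable at `r = t`, whereas `(t -
r)⁻¹` is not. -/
theorem one_sub_rpow_le {s t : ℝ} (ht : 0 < t) (hts : t ≤ s) :
    1 - (t / s) ^ ((d : ℝ) / 2) ≤ d * √((s - t) / t) := by
  have hs : 0 < s := ht.trans_le hts
  have h1 : t / s ≤ 1 := (div_le_one hs).2 hts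
  have h0 : 0 < t / s := by positivity
  have hp : (t / s) ^ d ≤ (t / s) ^ ((d : ℝ) / 2) := by
    rw [← Real.rpow_natCast]
    exact Real.rpow_le_rpow_of_exponent_ge h0 h1 (by linarith [d.cast_nonneg (α := ℝ)])
  have hb := one_add_mul_le_pow (a := t / s - 1) (by linarith) d
  rw [add_sub_cancel] at hb
  set q : ℝ := √((s - t) / t)
  have hq0 : 0 ≤ q := Real.sqrt_nonneg _
  have hq : q ^ 2 = (s - t) / t := Real.sq_sqrt (div_nonneg (sub_nonneg.2 hts) ht.le)
  have hst : s = t * (1 + q ^ 2) := by rw [hq]; field_simp; ring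
  have hle : 1 - t / s ≤ q := by
    have : t / s = 1 / (1 + q ^ 2) := by rw [hst]; field_simp
    rw [this, one_sub_div (by positivity), div_le_iff₀ (by positivity)]
    nlinarith [mul_nonneg hq0 (sq_nonneg (q - 1)), mul_nonneg hq0 hq0]
  nlinarith [mul_le_mul_of_nonneg_left hle (d.cast_nonneg (α := ℝ))]

theorem integral_abs_heatKernel_sub_le {s t : ℝ} (ht : 0 < t) (hts : t ≤ s) :
    ∫ x : EuclideanSpace ℝ (Fin d), |heatKernel s x - heatKernel t x| ≤
      2 * d * √((s - t) / t) := by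
  have hs : 0 < s := ht.trans_le hts
  set c : ℝ := (t / s) ^ ((d : ℝ) / 2)
  have hc : c ≤ 1 := Real.rpow_le_one (by positivity) ((div_le_one hs).2 hts) (by positivity)
  have hit := integrable_heatKernel (d := d) ht
  have his := integrable_heatKernel (d := d) hs
  calc ∫ x : EuclideanSpace ℝ (Fin d), |heatKernel s x - heatKernel t x|
      ≤ ∫ x : EuclideanSpace ℝ (Fin d),
        ((heatKernel s x - c * heatKernel t x) + (1 - c) * heatKernel t x) := by
        refine integral_mono (his.sub hit).abs
          ((his.sub (hit.const_mul c)).add (hit.const_mul (1 - c))) fun x => ?_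
        have h1 := rpow_mul_heatKernel_le ht hts x
        have h2 := mul_nonneg (sub_nonneg.2 hc) (heatKernel_nonneg ht.le x)
        simp only [c] at *
        rw [abs_le]
        constructor <;> linarith
    _ = 2 * (1 - c) := by
        have hadd := integral_add (his.sub (hit.const_mul c)) (hit.const_mul (1 - c))
        simp only [Pi.sub_apply] at hadd
        rw [hadd, integral_sub his (hit.const_mul c), integral_const_mul, integral_const_mul,
          integral_heatKernel ht, integral_heatKernel hs]
        ring
    _ ≤ _ := by linarith [one_sub_rpow_le (d := d) ht hts]

/-- The Gaussian probability measure on `ℝᵈ` with density `K₁`. -/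
noncomputable def heatMeasure (d : ℕ) : Measure (EuclideanSpace ℝ (Fin d)) :=
  volume.withDensity fun x => ENNReal.ofReal (heatKernel 1 x)

instance isProbabilityMeasure_heatMeasure : IsProbabilityMeasure (heatMeasure d) := by
  constructor
  rw [heatMeasure, withDensity_apply _ .univ, Measure.restrict_univ,
    ← ofReal_integral_eq_lintegral_ofReal (integrable_heatKernel one_pos)
      (.of_forall fun x => heatKernel_nonneg zero_le_one x),
    integral_heatKernel one_pos, ENNReal.ofReal_one]

theorem integral_heatMeasure (h : EuclideanSpace ℝ (Fin d) → ℂ) :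
    ∫ z, h z ∂(heatMeasure d) = ∫ z, (heatKernel 1 z : ℂ) * h z := by
  rw [heatMeasure, integral_withDensity_eq_integral_toReal_smul
    (continuous_heatKernel 1).measurable.ennreal_ofReal (.of_forall fun x => ENNReal.ofReal_lt_top)]
  simp [ENNReal.toReal_ofReal (heatKernel_nonneg zero_le_one _)]

/-- The heat semigroup as a Gaussian average; unlike the convolution, it makes sense at `t = 0`. -/
noncomputable def heatAverage (t : ℝ) (h : EuclideanSpace ℝ (Fin d) → ℂ)
    (x : EuclideanSpace ℝ (Fin d)) : ℂ :=
  ∫ z, h (x + √t • z) ∂(heatMeasure d)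

theorem heatSemigroup_eq_heatAverage {t : ℝ} (ht : 0 < t) (h : EuclideanSpace ℝ (Fin d) → ℂ)
    (x : EuclideanSpace ℝ (Fin d)) : heatSemigroup t h x = heatAverage t h x := by
  have hst : 0 < √t := Real.sqrt_pos.2 ht
  have h1 := integral_add_left_eq_self (μ := volume)
    (fun y : EuclideanSpace ℝ (Fin d) => (heatKernel t (x - y) : ℂ) * h y) x
  have h2 := Measure.integral_comp_smul volume
    (fun y : EuclideanSpace ℝ (Fin d) => (heatKernel t (x - (x + y)) : ℂ) * h (x + y)) √t
  rw [heatSemigroup, heatAverage, integral_heatMeasure, ← h1]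
  simp only [sub_add_cancel_left, heatKernel_neg, heatKernel_smul ht, finrank_euclideanSpace_fin,
    Complex.ofReal_mul, mul_assoc, integral_const_mul] at h2 ⊢
  have hpos : 0 < (√t ^ d)⁻¹ := by positivity
  rw [abs_of_pos hpos, Complex.real_smul] at h2
  exact (mul_left_cancel₀ (Complex.ofReal_ne_zero.2 hpos.ne') h2).symm

theorem heatAverage_zero (h : EuclideanSpace ℝ (Fin d) → ℂ) (x : EuclideanSpace ℝ (Fin d)) :
    heatAverage 0 h x = h x := by
  simp [heatAverage]

theorem norm_heatAverage_le {h : EuclideanSpace ℝ (Fin d) → ℂ} {B : ℝ} (hB : ∀ y, ‖h y‖ ≤ B)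
    (t : ℝ) (x : EuclideanSpace ℝ (Fin d)) : ‖heatAverage t h x‖ ≤ B := by
  simpa [heatAverage] using norm_integral_le_of_norm_le_const (μ := heatMeasure d)
    (.of_forall fun z => hB (x + √t • z))

theorem integrable_heatAverage {h : EuclideanSpace ℝ (Fin d) → ℂ} (hc : Continuous h) {B : ℝ}
    (hB : ∀ y, ‖h y‖ ≤ B) (t : ℝ) (x : EuclideanSpace ℝ (Fin d)) :
    Integrable (fun z => h (x + √t • z)) (heatMeasure d) :=
  .of_bound (by fun_prop) B (.of_forall fun z => hB _)

theorem heatAverage_sub {h k : EuclideanSpace ℝ (Fin d) → ℂ} (hh : Continuous h)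
    (hk : Continuous k) {B B' : ℝ} (hB : ∀ y, ‖h y‖ ≤ B) (hB' : ∀ y, ‖k y‖ ≤ B') (t : ℝ)
    (x : EuclideanSpace ℝ (Fin d)) :
    heatAverage t (fun y => h y - k y) x = heatAverage t h x - heatAverage t k x :=
  integral_sub (integrable_heatAverage hh hB t x) (integrable_heatAverage hk hB' t x)

/-- Averages against a probability measure stay in closed half-planes. This is the maximum principle
in the form needed; a general `φ` covers `±Re` and `±Im`. -/
theorem le_heatAverage (φ : ℂ →L[ℝ] ℝ) {h : EuclideanSpace ℝ (Fin d) → ℂ} (hc : Continuous h)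
    {B : ℝ} (hB : ∀ y, ‖h y‖ ≤ B) {a : ℝ} (ha : ∀ y, a ≤ φ (h y)) (t : ℝ)
    (x : EuclideanSpace ℝ (Fin d)) : a ≤ φ (heatAverage t h x) := by
  have hi := integrable_heatAverage hc hB t x
  rw [heatAverage, ← φ.integral_comp_comm hi]
  simpa using integral_mono (μ := heatMeasure d) (integrable_const a) (φ.integrable_comp hi)
    fun z => ha (x + √t • z)

theorem norm_heatAverage_sub_le {h : EuclideanSpace ℝ (Fin d) → ℂ} (hc : Continuous h) {B : ℝ}
    (hB : ∀ y, ‖h y‖ ≤ B) {s t : ℝ} (ht : 0 < t) (hts : t ≤ s)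
    (x : EuclideanSpace ℝ (Fin d)) :
    ‖heatAverage s h x - heatAverage t h x‖ ≤ 2 * d * B * √((s - t) / t) := by
  have hs : 0 < s := ht.trans_le hts
  have hB0 : 0 ≤ B := (norm_nonneg _).trans (hB 0)
  have hi : ∀ r : ℝ, 0 < r → Integrable fun y => (heatKernel r (x - y) : ℂ) * h y := by
    intro r hr
    exact ((integrable_heatKernel hr).comp_sub_left x).ofReal.mul_bdd
      (c := B) hc.aestronglyMeasurable (.of_forall hB)
  have hk : Integrable fun y : EuclideanSpace ℝ (Fin d) =>
      |heatKernel s (x - y) - heatKernel t (x - y)| :=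
    (((integrable_heatKernel hs).sub (integrable_heatKernel ht)).abs).comp_sub_left x
  rw [← heatSemigroup_eq_heatAverage hs, ← heatSemigroup_eq_heatAverage ht, heatSemigroup,
    heatSemigroup, ← integral_sub (hi s hs) (hi t ht)]
  calc ‖∫ y, ((heatKernel s (x - y) : ℂ) * h y - (heatKernel t (x - y) : ℂ) * h y)‖
      ≤ ∫ y, |heatKernel s (x - y) - heatKernel t (x - y)| * B := by
        refine norm_integral_le_of_norm_le (hk.mul_const B) (.of_forall fun y => ?_)
        rw [← sub_mul, norm_mul, ← Complex.ofReal_sub, Complex.norm_real, Real.norm_eq_abs]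
        gcongr
        exact hB y
    _ = (∫ y : EuclideanSpace ℝ (Fin d), |heatKernel s y - heatKernel t y|) * B := by
        rw [integral_mul_const, integral_sub_left_eq_self
          (fun y : EuclideanSpace ℝ (Fin d) => |heatKernel s y - heatKernel t y|) volume x]
    _ ≤ (2 * d * √((s - t) / t)) * B := by
        gcongr
        exact integral_abs_heatKernel_sub_le ht hts
    _ = _ := by ring

/-- The measure is fixed, so dominated convergence with a constant bound works even where `τ`
vanishes. For `τ < 0` the square root is `0` and the average is evaluation. -/
theorem continuous_heatAverage {X : Type*} [TopologicalSpace X] [FirstCountableTopology X]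
    {f : X → EuclideanSpace ℝ (Fin d) → ℂ} (hf : Continuous (Function.uncurry f)) {B : ℝ}
    (hB : ∀ p y, ‖f p y‖ ≤ B) {τ : X → ℝ} (hτ : Continuous τ)
    {ξ : X → EuclideanSpace ℝ (Fin d)} (hξ : Continuous ξ) :
    Continuous fun p => heatAverage (τ p) (f p) (ξ p) := by
  refine continuous_of_dominated (bound := fun _ => B) (fun p => ?_)
    (fun p => .of_forall fun z => hB _ _) (integrable_const B) (.of_forall fun z => ?_)
  · exact (hf.comp (continuous_const.prodMk (by fun_prop :
      Continuous fun z => ξ p + √(τ p) • z))).aestronglyMeasurable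
  · exact hf.comp (continuous_id.prodMk (by fun_prop : Continuous fun p => ξ p + √(τ p) • z))

end HeatKernel

/-! ### The Duhamel integral -/

section DuhamelIntegral

variable {d : ℕ}

/-- The Duhamel integral `∫₀ᵗ e^{(t-s)Δ} f(s) ds`. -/
noncomputable def duhamelIntegral (f : ℝ → EuclideanSpace ℝ (Fin d) → ℂ) (t : ℝ)
    (x : EuclideanSpace ℝ (Fin d)) : ℂ :=
  ∫ s in (0 : ℝ)..t, heatAverage (t - s) (f s) x

variable {f : ℝ → EuclideanSpace ℝ (Fin d) → ℂ}

/-- The integrands can differ only at the endpoint `s = t`, a null set. -/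
theorem integral_heatSemigroup_eq_duhamelIntegral {t : ℝ} (ht : 0 ≤ t)
    (x : EuclideanSpace ℝ (Fin d)) :
    ∫ s in (0 : ℝ)..t, heatSemigroup (t - s) (f s) x = duhamelIntegral f t x := by
  refine intervalIntegral.integral_congr_ae ?_
  have : ∀ᵐ s : ℝ, s ≠ t := Measure.ae_ne volume t
  filter_upwards [this] with s hs hst
  rw [uIoc_of_le ht] at hst
  exact heatSemigroup_eq_heatAverage (sub_pos.2 (hst.2.lt_of_ne hs)) _ _

theorem duhamelIntegral_congr {k : ℝ → EuclideanSpace ℝ (Fin d) → ℂ} {t : ℝ} (ht : 0 ≤ t)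
    (h : ∀ s ∈ Icc 0 t, f s = k s) (x : EuclideanSpace ℝ (Fin d)) :
    duhamelIntegral f t x = duhamelIntegral k t x := by
  refine intervalIntegral.integral_congr fun s hs => ?_
  rw [uIcc_of_le ht] at hs
  simp only [h s hs]

theorem continuous_heatAverage_sub (hf : Continuous (Function.uncurry f)) {B : ℝ}
    (hB : ∀ s y, ‖f s y‖ ≤ B) (t : ℝ) (x : EuclideanSpace ℝ (Fin d)) :
    Continuous fun s => heatAverage (t - s) (f s) x :=
  continuous_heatAverage hf hB (by fun_prop) continuous_const

theorem continuous_duhamelIntegral (hf : Continuous (Function.uncurry f)) {B : ℝ}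
    (hB : ∀ s y, ‖f s y‖ ≤ B) :
    Continuous fun p : ℝ × EuclideanSpace ℝ (Fin d) => duhamelIntegral f p.1 p.2 := by
  refine intervalIntegral.continuous_parametric_intervalIntegral_of_continuous
    (f := fun (p : ℝ × EuclideanSpace ℝ (Fin d)) s => heatAverage (p.1 - s) (f s) p.2) ?_
    continuous_fst
  exact continuous_heatAverage
    (f := fun (q : (ℝ × EuclideanSpace ℝ (Fin d)) × ℝ) => f q.2)
    (hf.comp (by fun_prop :
      Continuous fun r : ((ℝ × EuclideanSpace ℝ (Fin d)) × ℝ) × EuclideanSpace ℝ (Fin d) =>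
        (r.1.2, r.2)))
    (fun q y => hB _ y) (by fun_prop) (by fun_prop)

theorem norm_duhamelIntegral_le {b : ℝ → ℝ} {t : ℝ} (ht : 0 ≤ t) (hb : Continuous b)
    (h : ∀ s ∈ Icc 0 t, ∀ y, ‖f s y‖ ≤ b s) (x : EuclideanSpace ℝ (Fin d)) :
    ‖duhamelIntegral f t x‖ ≤ ∫ s in (0 : ℝ)..t, b s :=
  intervalIntegral.norm_integral_le_of_norm_le ht
    (.of_forall fun s hs => norm_heatAverage_le (h s (Ioc_subset_Icc_self hs)) _ _)
    (hb.intervalIntegrable _ _)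

theorem norm_duhamelIntegral_le_mul {B t : ℝ} (ht : 0 ≤ t)
    (h : ∀ s ∈ Icc 0 t, ∀ y, ‖f s y‖ ≤ B) (x : EuclideanSpace ℝ (Fin d)) :
    ‖duhamelIntegral f t x‖ ≤ B * t := by
  simpa [mul_comm] using norm_duhamelIntegral_le ht continuous_const h x

/-- The gain `1 / l` drives both the contraction and the Gronwall iteration. -/
theorem norm_duhamelIntegral_le_exp {C l t : ℝ} (hC : 0 ≤ C) (hl : 0 < l) (ht : 0 ≤ t)
    (h : ∀ s ∈ Icc 0 t, ∀ y, ‖f s y‖ ≤ C * Real.exp (l * s)) (x : EuclideanSpace ℝ (Fin d)) :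
    ‖duhamelIntegral f t x‖ ≤ C / l * Real.exp (l * t) := by
  refine (norm_duhamelIntegral_le ht (by fun_prop) h x).trans ?_
  rw [intervalIntegral.integral_const_mul,
    intervalIntegral.integral_comp_mul_left (fun s => Real.exp s) hl.ne', integral_exp,
    mul_zero, Real.exp_zero, smul_eq_mul, div_mul_eq_mul_div, mul_div_assoc, inv_mul_eq_div]
  gcongr
  linarith

theorem duhamelIntegral_sub {k : ℝ → EuclideanSpace ℝ (Fin d) → ℂ}
    (hf : Continuous (Function.uncurry f)) (hk : Continuous (Function.uncurry k)) {B B' : ℝ}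
    (hB : ∀ s y, ‖f s y‖ ≤ B) (hB' : ∀ s y, ‖k s y‖ ≤ B') (t : ℝ)
    (x : EuclideanSpace ℝ (Fin d)) :
    duhamelIntegral (fun s y => f s y - k s y) t x =
      duhamelIntegral f t x - duhamelIntegral k t x := by
  unfold duhamelIntegral
  rw [← intervalIntegral.integral_sub
    ((continuous_heatAverage_sub hf hB t x).intervalIntegrable _ _)
    ((continuous_heatAverage_sub hk hB' t x).intervalIntegrable _ _)]
  congr 1 with s
  exact heatAverage_sub (hf.uncurry_left s) (hk.uncurry_left s) (hB s) (hB' s) _ x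

theorem mul_le_duhamelIntegral (φ : ℂ →L[ℝ] ℝ) (hf : Continuous (Function.uncurry f)) {B : ℝ}
    (hB : ∀ s y, ‖f s y‖ ≤ B) {a t : ℝ} (ht : 0 ≤ t) (ha : ∀ s ∈ Icc 0 t, ∀ y, a ≤ φ (f s y))
    (x : EuclideanSpace ℝ (Fin d)) : a * t ≤ φ (duhamelIntegral f t x) := by
  have hi := (continuous_heatAverage_sub hf hB t x)
  rw [duhamelIntegral, ← φ.intervalIntegral_comp_comm (hi.intervalIntegrable _ _)]
  have := intervalIntegral.integral_mono_on (μ := volume) (f := fun _ => a) ht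
    (continuous_const.intervalIntegrable _ _)
    ((φ.continuous.comp hi).intervalIntegrable 0 t)
    fun s hs => le_heatAverage φ (hf.uncurry_left s) (hB s) (ha s hs) (t - s) x
  simpa [mul_comm] using this

theorem integral_sqrt_div_sub_le {h t : ℝ} (hh : 0 ≤ h) (ht : 0 ≤ t) :
    IntervalIntegrable (fun s => √(h / (t - s))) volume 0 t ∧
      ∫ s in (0 : ℝ)..t, √(h / (t - s)) = 2 * √(h * t) := by
  have hi : IntervalIntegrable (fun r : ℝ => √h * r ^ (-(1 / 2) : ℝ)) volume 0 t :=
    (intervalIntegral.intervalIntegrable_rpow' (by norm_num)).const_mul _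
  -- At `r = 0` both sides are `0` by the conventions for division and for `0 ^ (-1/2)`.
  have heq : EqOn (fun r : ℝ => √h * r ^ (-(1 / 2) : ℝ)) (fun r => √(h / r)) (uIcc 0 t) := by
    intro r hr
    rw [uIcc_of_le ht] at hr
    simp only
    rw [Real.sqrt_div hh, Real.rpow_neg hr.1, ← Real.sqrt_eq_rpow, div_eq_mul_inv]
  have hi' : IntervalIntegrable (fun r : ℝ => √(h / r)) volume 0 t :=
    hi.congr (heq.mono uIoc_subset_uIcc)
  constructor
  · simpa using (hi'.comp_sub_left t).symm
  · rw [intervalIntegral.integral_comp_sub_left (fun r => √(h / r)), sub_self, sub_zero,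
      ← intervalIntegral.integral_congr heq, intervalIntegral.integral_const_mul,
      integral_rpow (Or.inl (by norm_num)), Real.zero_rpow (by norm_num),
      show (-(1 / 2) + 1 : ℝ) = 1 / 2 by norm_num, ← Real.sqrt_eq_rpow, Real.sqrt_mul hh]
    ring

/-- On `[t, s]` the integrand is bounded by `B`. On `[0, t]` the kernels at times `s - r` and `t -
r` are compared, with an integrable singularity at `r = t`. -/
theorem norm_duhamelIntegral_sub_le (hf : Continuous (Function.uncurry f)) {B : ℝ}
    (hB : ∀ s y, ‖f s y‖ ≤ B) {s t : ℝ} (ht : 0 ≤ t) (hts : t ≤ s)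
    (x : EuclideanSpace ℝ (Fin d)) :
    ‖duhamelIntegral f s x - duhamelIntegral f t x‖ ≤
      B * (s - t) + 4 * d * B * √((s - t) * t) := by
  have hc := continuous_heatAverage_sub hf hB s x
  have hc' := continuous_heatAverage_sub hf hB t x
  have hsplit : duhamelIntegral f s x - duhamelIntegral f t x =
      (∫ r in t..s, heatAverage (s - r) (f r) x) +
        ∫ r in (0 : ℝ)..t, (heatAverage (s - r) (f r) x - heatAverage (t - r) (f r) x) := by
    unfold duhamelIntegral
    rw [intervalIntegral.integral_sub (hc.intervalIntegrable _ _) (hc'.intervalIntegrable _ _),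
      ← intervalIntegral.integral_add_adjacent_intervals (hc.intervalIntegrable 0 t)
        (hc.intervalIntegrable t s)]
    ring
  have h1 : ‖∫ r in t..s, heatAverage (s - r) (f r) x‖ ≤ B * (s - t) := by
    have := intervalIntegral.norm_integral_le_of_norm_le_const (a := t) (b := s)
      fun r _ => norm_heatAverage_le (hB r) (s - r) x
    rwa [abs_of_nonneg (sub_nonneg.2 hts)] at this
  obtain ⟨hi, hint⟩ := integral_sqrt_div_sub_le (sub_nonneg.2 hts) ht
  have h2 : ‖∫ r in (0 : ℝ)..t, (heatAverage (s - r) (f r) x - heatAverage (t - r) (f r) x)‖ ≤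
      ∫ r in (0 : ℝ)..t, 2 * d * B * √((s - t) / (t - r)) := by
    refine intervalIntegral.norm_integral_le_of_norm_le ht ?_ (hi.const_mul _)
    filter_upwards [Measure.ae_ne volume t] with r hr hrt
    have := norm_heatAverage_sub_le (hf.uncurry_left r) (hB r)
      (sub_pos.2 (hrt.2.lt_of_ne hr)) (sub_le_sub_right hts r) x
    rwa [sub_sub_sub_cancel_right] at this
  rw [intervalIntegral.integral_const_mul, hint] at h2
  rw [hsplit]
  refine (norm_add_le _ _).trans ?_
  linarith

end DuhamelIntegral

/-! ### Mild solutions of semilinear heat equations -/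

section MildSolution

variable {d : ℕ}

/-- A heat equation with a bounded and globally Lipschitz reaction term has a global mild
solution. It is extended to negative times by its initial value. -/
theorem exists_mild_solution {F : ℂ → ℂ} {C : NNReal} (hF : LipschitzWith C F) {M : ℝ}
    (hM : ∀ z, ‖F z‖ ≤ M) (g : EuclideanSpace ℝ (Fin d) →ᵇ ℂ) :
    ∃ U : ℝ → EuclideanSpace ℝ (Fin d) → ℂ, Continuous (Function.uncurry U) ∧
      ∀ t x, U t x = heatAverage (max t 0) g x +
        duhamelIntegral (fun s y => F (U s y)) (max t 0) x := by
  have hM0 : 0 ≤ M := (norm_nonneg _).trans (hM 0)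
  -- Chosen so that `C / l ≤ 1 / 2` (contraction) and `l ≥ 1` (boundedness of `S W`).
  set l : ℝ := 2 * C + 1
  have hl : 1 ≤ l := by simp [l]
  have hl0 : 0 < l := one_pos.trans_le hl
  -- The unknown `W` stands for `e^(-lt) U`, so the weighted norm of `U` is the ordinary sup norm of
  -- `W`; `max s 0` freezes negative times.
  let R : (ℝ × EuclideanSpace ℝ (Fin d) →ᵇ ℂ) → ℝ → EuclideanSpace ℝ (Fin d) → ℂ :=
    fun W s y => F (Real.exp (l * max s 0) • W (s, y))
  have hR : ∀ W, Continuous (Function.uncurry (R W)) := fun W =>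
    hF.continuous.comp (by fun_prop :
      Continuous fun p : ℝ × EuclideanSpace ℝ (Fin d) => Real.exp (l * max p.1 0) • W (p.1, p.2))
  let S : (ℝ × EuclideanSpace ℝ (Fin d) →ᵇ ℂ) → ℝ × EuclideanSpace ℝ (Fin d) → ℂ :=
    fun W p => Real.exp (-(l * max p.1 0)) • (heatAverage (max p.1 0) g p.2 +
      duhamelIntegral (R W) (max p.1 0) p.2)
  have hScont : ∀ W, Continuous (S W) := fun W => by
    have h1 : Continuous fun p : ℝ × EuclideanSpace ℝ (Fin d) =>
        heatAverage (max p.1 0) g p.2 :=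
      continuous_heatAverage (f := fun _ => g) (g.continuous.comp continuous_snd)
        (fun _ => g.norm_coe_le_norm) (by fun_prop) continuous_snd
    have h2 : Continuous fun p : ℝ × EuclideanSpace ℝ (Fin d) =>
        duhamelIntegral (R W) (max p.1 0) p.2 :=
      (continuous_duhamelIntegral (hR W) (fun _ _ => hM _)).comp
        (by fun_prop : Continuous fun p : ℝ × EuclideanSpace ℝ (Fin d) => (max p.1 0, p.2))
    exact (by fun_prop : Continuous fun p : ℝ × EuclideanSpace ℝ (Fin d) =>
      Real.exp (-(l * max p.1 0))).smul (h1.add h2)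
  -- The weight absorbs the linear growth of the Duhamel term, since `t ≤ e^(lt)`.
  have hSbound : ∀ W p, ‖S W p‖ ≤ ‖g‖ + M := fun W p => by
    have ht : 0 ≤ max p.1 0 := le_max_right _ _
    have h1 := norm_heatAverage_le g.norm_coe_le_norm (max p.1 0) p.2
    have h2 := norm_duhamelIntegral_le_mul (f := R W) ht (fun _ _ _ => hM _) p.2
    have h3 : max p.1 0 ≤ Real.exp (l * max p.1 0) :=
      ((le_mul_of_one_le_left ht hl).trans (by linarith)).trans (Real.add_one_le_exp _)
    have h4 : Real.exp (-(l * max p.1 0)) ≤ 1 := Real.exp_le_one_iff.2 (by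
      have := mul_nonneg hl0.le ht
      linarith)
    have h5 : Real.exp (-(l * max p.1 0)) * max p.1 0 ≤ 1 := by
      rw [Real.exp_neg, inv_mul_le_iff₀ (Real.exp_pos _), mul_one]
      exact h3
    rw [norm_smul, Real.norm_of_nonneg (Real.exp_pos _).le]
    calc _ ≤ Real.exp (-(l * max p.1 0)) * (‖g‖ + M * max p.1 0) := by
          gcongr
          exact (norm_add_le _ _).trans (add_le_add h1 h2)
      _ = Real.exp (-(l * max p.1 0)) * ‖g‖ + M * (Real.exp (-(l * max p.1 0)) * max p.1 0) := by
          ring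
      _ ≤ 1 * ‖g‖ + M * 1 := by gcongr
      _ = _ := by ring
  let Φ : (ℝ × EuclideanSpace ℝ (Fin d) →ᵇ ℂ) → (ℝ × EuclideanSpace ℝ (Fin d) →ᵇ ℂ) :=
    fun W => ofNormedAddCommGroup (S W) (hScont W) (‖g‖ + M) (hSbound W)
  have hΦ : ContractingWith (1 / 2) Φ := by
    refine ⟨by norm_num, LipschitzWith.of_dist_le_mul fun W V => ?_⟩
    refine (dist_le (by positivity)).2 fun p => ?_
    have ht : 0 ≤ max p.1 0 := le_max_right _ _
    have hdiff : ∀ s ∈ Icc 0 (max p.1 0), ∀ y, ‖R W s y - R V s y‖ ≤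
        C * dist W V * Real.exp (l * s) := by
      intro s hs y
      have h1 := hF.dist_le_mul (Real.exp (l * max s 0) • W (s, y))
        (Real.exp (l * max s 0) • V (s, y))
      rw [dist_eq_norm, dist_smul₀, Real.norm_of_nonneg (Real.exp_pos _).le,
        max_eq_left hs.1] at h1
      have h2 := dist_coe_le_dist (f := W) (g := V) (s, y)
      simp only [R, max_eq_left hs.1]
      refine h1.trans ?_
      rw [mul_assoc, mul_comm (dist W V)]
      gcongr
    have h1 := norm_duhamelIntegral_le_exp (by positivity) hl0 ht hdiff p.2
    rw [duhamelIntegral_sub (hR W) (hR V) (fun _ _ => hM _) (fun _ _ => hM _)] at h1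
    have h2 : dist (Φ W p) (Φ V p) = Real.exp (-(l * max p.1 0)) *
        ‖duhamelIntegral (R W) (max p.1 0) p.2 - duhamelIntegral (R V) (max p.1 0) p.2‖ := by
      simp only [Φ, S, coe_ofNormedAddCommGroup]
      rw [dist_smul₀, Real.norm_of_nonneg (Real.exp_pos _).le, dist_add_left, dist_eq_norm]
    have h3 : (C : ℝ) / l ≤ 1 / 2 := by
      rw [div_le_div_iff₀ hl0 two_pos]
      simp only [l]
      linarith
    rw [h2]
    calc _ ≤ Real.exp (-(l * max p.1 0)) *
          (C * dist W V / l * Real.exp (l * max p.1 0)) := by gcongr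
      _ = C / l * dist W V := by
          rw [Real.exp_neg]
          field_simp
      _ ≤ 1 / 2 * dist W V := by gcongr
      _ = _ := by simp
  set W := ContractingWith.fixedPoint Φ hΦ
  have hW : Φ W = W := hΦ.fixedPoint_isFixedPt
  refine ⟨fun t x => Real.exp (l * max t 0) • W (t, x), by
    change Continuous fun p : ℝ × EuclideanSpace ℝ (Fin d) =>
      Real.exp (l * max p.1 0) • W (p.1, p.2)
    fun_prop, fun t x => ?_⟩
  have h : W (t, x) = S W (t, x) := by
    conv_lhs => rw [← hW]
    rfl
  have h2 : Real.exp (l * max t 0) • S W (t, x) =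
      heatAverage (max t 0) g x + duhamelIntegral (R W) (max t 0) x := by
    simp only [S]
    rw [smul_smul, ← Real.exp_add, add_neg_cancel, Real.exp_zero, one_smul]
  rw [← h] at h2
  exact h2

/-- Gronwall uniqueness: two bounded functions whose difference is a Duhamel integral of a term
controlled by that difference agree. -/
theorem eq_of_sub_eq_duhamelIntegral_sub {u v f k : ℝ → EuclideanSpace ℝ (Fin d) → ℂ} {T C β : ℝ}
    (hC : 0 ≤ C) (hbd : ∀ t ∈ Icc 0 T, ∀ x, ‖u t x - v t x‖ ≤ β)
    (hfk : ∀ t ∈ Icc 0 T, ∀ x, ‖f t x - k t x‖ ≤ C * ‖u t x - v t x‖)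
    (h : ∀ t ∈ Icc 0 T, ∀ x,
      u t x - v t x = duhamelIntegral (fun s y => f s y - k s y) t x)
    {t : ℝ} (ht : t ∈ Icc 0 T) (x : EuclideanSpace ℝ (Fin d)) : u t x = v t x := by
  have hβ : 0 ≤ β := (norm_nonneg _).trans (hbd t ht x)
  have hl : 0 < 2 * C + 1 := by positivity
  -- Each pass through the Duhamel integral gains the factor `C / (2C + 1) ≤ 1 / 2`.
  have key : ∀ n : ℕ, ∀ t ∈ Icc 0 T, ∀ x,
      ‖u t x - v t x‖ ≤ β * (1 / 2) ^ n * Real.exp ((2 * C + 1) * t) := by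
    intro n
    induction n with
    | zero =>
      intro t ht x
      refine (hbd t ht x).trans ?_
      rw [pow_zero, mul_one]
      exact le_mul_of_one_le_right hβ (Real.one_le_exp (mul_nonneg hl.le ht.1))
    | succ n ih =>
      intro t ht x
      have h1 := norm_duhamelIntegral_le_exp (f := fun s y => f s y - k s y)
        (C := C * (β * (1 / 2) ^ n)) (by positivity) hl ht.1 (fun s hs y => by
          have hs' : s ∈ Icc 0 T := ⟨hs.1, hs.2.trans ht.2⟩
          refine (hfk s hs' y).trans ?_
          rw [mul_assoc]
          gcongr
          exact ih s hs' y) x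
      rw [h t ht x]
      refine h1.trans ?_
      gcongr
      rw [div_le_iff₀ hl, pow_succ]
      nlinarith [show 0 ≤ β * (1 / 2) ^ n by positivity]
  have hlim : Filter.Tendsto (fun n : ℕ => β * (1 / 2) ^ n * Real.exp ((2 * C + 1) * t))
      Filter.atTop (nhds 0) := by
    simpa using ((tendsto_pow_atTop_nhds_zero_of_lt_one (r := (1 / 2 : ℝ)) (by norm_num)
      (by norm_num)).const_mul β).mul_const (Real.exp ((2 * C + 1) * t))
  have := ge_of_tendsto' hlim fun n => key n t ht x
  exact sub_eq_zero.1 (norm_le_zero_iff.1 this)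

/-- A mild solution with a bounded reaction term is norm continuous at positive times. -/
theorem continuousAt_of_mild {f : ℝ → EuclideanSpace ℝ (Fin d) → ℂ}
    (hf : Continuous (Function.uncurry f)) {M : ℝ} (hM : ∀ s y, ‖f s y‖ ≤ M)
    {g : EuclideanSpace ℝ (Fin d) →ᵇ ℂ} {u : ℝ → (EuclideanSpace ℝ (Fin d) →ᵇ ℂ)}
    (hu : ∀ t, 0 ≤ t → ∀ x, u t x = heatAverage t g x + duhamelIntegral f t x)
    {t : ℝ} (ht : 0 < t) : ContinuousAt u t := by
  have hM0 : 0 ≤ M := (norm_nonneg _).trans (hM 0 0)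
  -- A modulus valid for `0 < r ≤ s`; inserting `max s t` and `min s t` treats both sides of `t` at
  -- once.
  let w : ℝ → ℝ → ℝ := fun s r =>
    2 * d * ‖g‖ * √((s - r) / r) + (M * (s - r) + 4 * d * M * √((s - r) * r))
  have hle : ∀ s r, 0 < r → r ≤ s → dist (u s) (u r) ≤ w s r := by
    intro s r hr hrs
    have hsr := sub_nonneg.2 hrs
    refine (dist_le (by positivity)).2 fun x => ?_
    rw [hu s (hr.le.trans hrs), hu r hr.le, dist_eq_norm, add_sub_add_comm]
    exact (norm_add_le _ _).trans (add_le_add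
      (norm_heatAverage_sub_le g.continuous g.norm_coe_le_norm hr hrs x)
      (norm_duhamelIntegral_sub_le hf hM hr.le hrs x))
  rw [ContinuousAt, tendsto_iff_dist_tendsto_zero]
  have hw : Filter.Tendsto (fun s => w (max s t) (min s t)) (nhds t) (nhds 0) := by
    have hc : ContinuousAt (fun s => w (max s t) (min s t)) t := by
      have hne : min t t ≠ 0 := by rw [min_self]; exact ht.ne'
      have h1 : ContinuousAt (fun s => (max s t - min s t) / min s t) t :=
        ContinuousAt.div (by fun_prop) (by fun_prop) hne
      have h2 : ContinuousAt (fun s => √((max s t - min s t) / min s t)) t := h1.sqrt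
      simp only [w]
      fun_prop
    have h0 : w (max t t) (min t t) = 0 := by simp [w]
    have := hc.tendsto
    rwa [h0] at this
  refine squeeze_zero' (.of_forall fun s => dist_nonneg) ?_ hw
  filter_upwards [lt_mem_nhds ht] with s hs
  rcases le_total s t with h | h
  · rw [max_eq_right h, min_eq_left h, dist_comm]
    exact hle t s hs h
  · rw [max_eq_left h, min_eq_right h]
    exact hle s t ht h

/-- Uniform continuity of `g` makes its translates `τ z` depend norm-continuously on `z`; the
modulus is the Gaussian mean of `‖τ (√t • z) - g‖`. -/
theorem exists_modulus_heatAverage_of_uniformContinuous {g : EuclideanSpace ℝ (Fin d) →ᵇ ℂ}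
    (hg : UniformContinuous g) :
    ∃ ω : ℝ → ℝ, Continuous ω ∧ ω 0 = 0 ∧ ∀ t x, ‖heatAverage t g x - g x‖ ≤ ω t := by
  let τ : EuclideanSpace ℝ (Fin d) → (EuclideanSpace ℝ (Fin d) →ᵇ ℂ) := fun z =>
    g.compContinuous ⟨fun x => x + z, by fun_prop⟩
  have hτ : Continuous τ := by
    refine Metric.continuous_iff.2 fun z ε hε => ?_
    obtain ⟨δ, hδ, h⟩ := Metric.uniformContinuous_iff.1 hg (ε / 2) (half_pos hε)
    refine ⟨δ, hδ, fun w hw =>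
      ((dist_le (half_pos hε).le).2 fun x => ?_).trans_lt (half_lt_self hε)⟩
    exact (h (by simpa using hw)).le
  have hbd : ∀ z, ‖‖τ z - g‖‖ ≤ 2 * ‖g‖ := fun z => by
    rw [norm_norm]
    refine (norm_sub_le _ _).trans ?_
    have : ‖τ z‖ ≤ ‖g‖ := norm_compContinuous_le g _
    linarith
  refine ⟨fun t => ∫ z, ‖τ (√t • z) - g‖ ∂(heatMeasure d), ?_, ?_, fun t x => ?_⟩
  · exact continuous_of_dominated (bound := fun _ => 2 * ‖g‖)
      (fun t => Continuous.aestronglyMeasurable (by fun_prop))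
      (fun t => .of_forall fun z => hbd _) (integrable_const _) (.of_forall fun z => by fun_prop)
  · have : τ 0 = g := by ext x; simp [τ]
    simp [this]
  · have hi := integrable_heatAverage g.continuous g.norm_coe_le_norm t x
    have h1 : heatAverage t g x - g x = ∫ z, (g (x + √t • z) - g x) ∂(heatMeasure d) := by
      rw [integral_sub hi (integrable_const _)]
      simp [heatAverage]
    rw [h1]
    refine norm_integral_le_of_norm_le (Integrable.of_bound (Continuous.aestronglyMeasurable
      (by fun_prop)) (2 * ‖g‖) (.of_forall fun z => hbd _)) (.of_forall fun z => ?_)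
    exact (τ (√t • z) - g).norm_coe_le_norm x

/-- A mild solution with a bounded reaction term and uniformly continuous initial value is norm
continuous at time zero. -/
theorem continuousWithinAt_zero_of_mild {f : ℝ → EuclideanSpace ℝ (Fin d) → ℂ} {M : ℝ}
    (hM : ∀ s y, ‖f s y‖ ≤ M) {g : EuclideanSpace ℝ (Fin d) →ᵇ ℂ} (hg : UniformContinuous g)
    {u : ℝ → (EuclideanSpace ℝ (Fin d) →ᵇ ℂ)}
    (hu : ∀ t, 0 ≤ t → ∀ x, u t x = heatAverage t g x + duhamelIntegral f t x) :
    ContinuousWithinAt u (Ici 0) 0 := by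
  have hM0 : 0 ≤ M := (norm_nonneg _).trans (hM 0 0)
  obtain ⟨ω, hω, hω0, hle⟩ := exists_modulus_heatAverage_of_uniformContinuous hg
  have h0 : u 0 = g := by
    ext x
    rw [hu 0 le_rfl, heatAverage_zero]
    simp [duhamelIntegral]
  rw [ContinuousWithinAt, tendsto_iff_dist_tendsto_zero, h0]
  have hlim : Filter.Tendsto (fun t => ω t + M * t) (nhdsWithin 0 (Ici 0)) (nhds 0) := by
    have : Continuous fun t => ω t + M * t := by fun_prop
    have := this.tendsto 0
    rw [hω0, mul_zero, add_zero] at this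
    exact this.mono_left nhdsWithin_le_nhds
  refine squeeze_zero' (.of_forall fun s => dist_nonneg) ?_ hlim
  filter_upwards [self_mem_nhdsWithin] with t ht
  have ht : 0 ≤ t := ht
  refine (dist_le (add_nonneg ((norm_nonneg _).trans (hle t 0)) (mul_nonneg hM0 ht))).2
    fun x => ?_
  rw [hu t ht, dist_eq_norm, add_sub_right_comm]
  exact (norm_add_le _ _).trans (add_le_add (hle t x)
    (norm_duhamelIntegral_le_mul ht (fun s _ y => hM s y) x))

end MildSolution

/-! ### The reaction-diffusion equation of the principal `L`-function -/

section ReactionDiffusion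

variable {d : ℕ}

/-- Boundedness and the distance from the pole place both solutions in a compact set `K` missing
`1`, where `L_m` is Lipschitz. No lower bound on the real parts is needed. -/
theorem IsDuhamelSolution.eqOn {m : ℕ} [NeZero m] {g : EuclideanSpace ℝ (Fin d) →ᵇ ℂ} {T : ℝ}
    (hT : 0 < T) {u v : ℝ → (EuclideanSpace ℝ (Fin d) →ᵇ ℂ)} (hu : IsDuhamelSolution m g T u)
    (hv : IsDuhamelSolution m g T v) : EqOn u v (Icc 0 T) := by
  set Lm := DirichletCharacter.LFunction (1 : DirichletCharacter ℂ m)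
  obtain ⟨β₁, hβ₁⟩ := hu.bounded
  obtain ⟨β₂, hβ₂⟩ := hv.bounded
  obtain ⟨ε₁, hε₁, hp₁⟩ := hu.away_from_pole
  obtain ⟨ε₂, hε₂, hp₂⟩ := hv.away_from_pole
  let K : Set ℂ := Metric.closedBall 0 (max β₁ β₂) ∩ {z | min ε₁ ε₂ ≤ |z.re - 1| + |z.im|}
  have hK : IsCompact K := (isCompact_closedBall _ _).inter_right
    (isClosed_le continuous_const (by fun_prop))
  have h1K : (1 : ℂ) ∉ K := fun h => by
    have h2 : min ε₁ ε₂ ≤ |(1 : ℂ).re - 1| + |(1 : ℂ).im| := h.2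
    rw [Complex.one_re, Complex.one_im, sub_self, abs_zero, add_zero] at h2
    exact absurd (lt_min hε₁ hε₂) (not_lt.2 h2)
  obtain ⟨C, hC⟩ := exists_lipschitzOnWith_LFunction_of_isCompact m hK h1K
  obtain ⟨B, hB⟩ := hK.exists_bound_of_continuousOn hC.continuousOn
  have huK : ∀ t ∈ Icc 0 T, ∀ x, u t x ∈ K := fun t ht x =>
    ⟨mem_closedBall_zero_iff.2 ((((u t).norm_coe_le_norm x).trans (hβ₁ t ht)).trans
      (le_max_left _ _)), (min_le_left _ _).trans (hp₁ t ht x)⟩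
  have hvK : ∀ t ∈ Icc 0 T, ∀ x, v t x ∈ K := fun t ht x =>
    ⟨mem_closedBall_zero_iff.2 ((((v t).norm_coe_le_norm x).trans (hβ₂ t ht)).trans
      (le_max_right _ _)), (min_le_right _ _).trans (hp₂ t ht x)⟩
  -- Clamping time to `[0, T]` makes the reaction terms continuous and bounded for all times, as the
  -- Duhamel lemmas require.
  let c : ℝ → ℝ := fun s => max 0 (min s T)
  have hc : ∀ s, c s ∈ Icc 0 T := fun s => ⟨le_max_left _ _, max_le hT.le (min_le_right _ _)⟩
  have hcid : ∀ s ∈ Icc 0 T, c s = s := fun s hs => by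
    simp only [c, min_eq_left hs.2, max_eq_right hs.1]
  let f : (ℝ → (EuclideanSpace ℝ (Fin d) →ᵇ ℂ)) → ℝ → EuclideanSpace ℝ (Fin d) → ℂ :=
    fun w s y => Lm (w (c s) y)
  have hf : ∀ w : ℝ → (EuclideanSpace ℝ (Fin d) →ᵇ ℂ), IsDuhamelSolution m g T w →
      (∀ t ∈ Icc 0 T, ∀ x, w t x ∈ K) → Continuous (Function.uncurry (f w)) := by
    intro w hw hwK
    have h1 : Continuous fun p : ℝ × EuclideanSpace ℝ (Fin d) => w (c p.1) p.2 :=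
      hw.continuousOn_joint.comp_continuous
        (by fun_prop : Continuous fun p : ℝ × EuclideanSpace ℝ (Fin d) => (c p.1, p.2))
        fun p => ⟨hc p.1, mem_univ _⟩
    exact hC.continuousOn.comp_continuous h1 fun p => hwK _ (hc p.1) p.2
  have hmild : ∀ w : ℝ → (EuclideanSpace ℝ (Fin d) →ᵇ ℂ), IsDuhamelSolution m g T w →
      ∀ t ∈ Icc 0 T, ∀ x, w t x = heatAverage t g x + duhamelIntegral (f w) t x := by
    intro w hw t ht x
    rcases ht.1.eq_or_lt with rfl | h0
    · rw [hw.initial, heatAverage_zero]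
      simp [duhamelIntegral]
    · rw [hw.duhamel t ⟨h0, ht.2⟩, heatSemigroup_eq_heatAverage h0,
        integral_heatSemigroup_eq_duhamelIntegral (f := fun s y => Lm (w s y)) ht.1]
      congr 1
      refine duhamelIntegral_congr ht.1 (fun s hs => ?_) x
      simp only [f, hcid s ⟨hs.1, hs.2.trans ht.2⟩]
  intro t ht
  ext x
  refine eq_of_sub_eq_duhamelIntegral_sub (u := fun t => u t) (v := fun t => v t) (f := f u)
    (k := f v) (T := T) (β := β₁ + β₂) C.coe_nonneg
    (fun t ht x => ?_) (fun t ht x => ?_) (fun t ht x => ?_) ht x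
  · exact (norm_sub_le _ _).trans (add_le_add (((u t).norm_coe_le_norm x).trans (hβ₁ t ht))
      (((v t).norm_coe_le_norm x).trans (hβ₂ t ht)))
  · simp only [f, hcid t ht]
    exact hC.norm_sub_le (huK t ht x) (hvK t ht x)
  · rw [duhamelIntegral_sub (hf u hu huK) (hf v hv hvK)
      (fun s y => hB _ (huK _ (hc s) y)) (fun s y => hB _ (hvK _ (hc s) y)),
      hmild u hu t ht x, hmild v hv t ht x, add_sub_add_left_eq_sub]

/-- The retraction of `ℂ` onto the half-plane `a ≤ Re z`. -/
noncomputable def clampRe (a : ℝ) (z : ℂ) : ℂ := ⟨max z.re a, z.im⟩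

theorem lipschitzWith_clampRe (a : ℝ) : LipschitzWith 1 (clampRe a) := by
  refine LipschitzWith.of_dist_le_mul fun z w => ?_
  rw [NNReal.coe_one, one_mul, dist_eq_norm, dist_eq_norm,
    ← sq_le_sq₀ (norm_nonneg _) (norm_nonneg _), Complex.sq_norm, Complex.sq_norm,
    Complex.normSq_apply, Complex.normSq_apply]
  simp only [clampRe, Complex.sub_re, Complex.sub_im]
  have := sq_le_sq.2 (abs_max_sub_max_le_abs z.re w.re a)
  nlinarith

theorem clampRe_of_le {a : ℝ} {z : ℂ} (h : a ≤ z.re) : clampRe a z = z := by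
  simp [clampRe, max_eq_left h]

theorem le_re_clampRe (a : ℝ) (z : ℂ) : a ≤ (clampRe a z).re := le_max_right _ _

end ReactionDiffusion

/-! ### The global solution and its linear bounds -/

theorem theorem1p2 (d : ℕ) (hd : 1 ≤ d) (m : ℕ) [NeZero m]
    (g : EuclideanSpace ℝ (Fin d) →ᵇ ℂ) (I₁ I₂ S₁ S₂ : ℝ)
    (hI₁ : I₁ = ⨅ x, (g x).re) (hI₂ : I₂ = ⨅ x, (g x).im)
    (hS₁ : S₁ = ⨆ x, (g x).re) (hS₂ : S₂ = ⨆ x, (g x).im)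
    (hg : max 1 (vanDeLuneAbscissa (1 : DirichletCharacter ℂ m)) < (I₁ : EReal)) :
    ∃ u : ℝ → (EuclideanSpace ℝ (Fin d) →ᵇ ℂ),
      -- `u` is a solution for all times
      (∀ T : ℝ, 0 < T → IsDuhamelSolution m g T u) ∧
      -- every local solution is a restriction of `u`
      (∀ T : ℝ, 0 < T → ∀ v : ℝ → (EuclideanSpace ℝ (Fin d) →ᵇ ℂ),
        IsDuhamelSolution m g T v → EqOn v u (Icc 0 T)) ∧
      -- if `g` is uniformly continuous, `u` is continuous in the norm up to the initial time
      (UniformContinuous g → ContinuousOn u (Ici 0)) ∧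
      -- bounds for the real and the imaginary part
      ∀ t : ℝ, 0 ≤ t → ∀ x : EuclideanSpace ℝ (Fin d),
        (max 0 (2 - (riemannZeta (I₁ : ℂ)).re) * t + I₁ ≤ (u t x).re ∧
          (u t x).re ≤ (riemannZeta (I₁ : ℂ)).re * t + S₁) ∧
        ((1 - (riemannZeta (I₁ : ℂ)).re) * t + I₂ ≤ (u t x).im ∧
          (u t x).im ≤ ((riemannZeta (I₁ : ℂ)).re - 1) * t + S₂) := by
  have hI : 1 < I₁ := by exact_mod_cast (max_lt_iff.1 hg).1
  have hre : ∀ y, |(g y).re| ≤ ‖g‖ := fun y =>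
    (Complex.abs_re_le_norm _).trans (g.norm_coe_le_norm y)
  have him : ∀ y, |(g y).im| ≤ ‖g‖ := fun y =>
    (Complex.abs_im_le_norm _).trans (g.norm_coe_le_norm y)
  have hgI₁ : ∀ y, I₁ ≤ (g y).re := fun y => hI₁ ▸
    ciInf_le ⟨-‖g‖, by rintro _ ⟨z, rfl⟩; exact (abs_le.1 (hre z)).1⟩ y
  have hgI₂ : ∀ y, I₂ ≤ (g y).im := fun y => hI₂ ▸
    ciInf_le ⟨-‖g‖, by rintro _ ⟨z, rfl⟩; exact (abs_le.1 (him z)).1⟩ y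
  have hgS₁ : ∀ y, (g y).re ≤ S₁ := fun y => hS₁ ▸
    le_ciSup (f := fun y => (g y).re)
      ⟨‖g‖, by rintro _ ⟨z, rfl⟩; exact (abs_le.1 (hre z)).2⟩ y
  have hgS₂ : ∀ y, (g y).im ≤ S₂ := fun y => hS₂ ▸
    le_ciSup (f := fun y => (g y).im)
      ⟨‖g‖, by rintro _ ⟨z, rfl⟩; exact (abs_le.1 (him z)).2⟩ y
  set ζ : ℝ := (riemannZeta (I₁ : ℂ)).re
  set Lm := DirichletCharacter.LFunction (1 : DirichletCharacter ℂ m)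
  let F : ℂ → ℂ := fun z => Lm (clampRe I₁ z)
  obtain ⟨C, hC⟩ := exists_lipschitzOnWith_LFunction m hI
  have hF : LipschitzWith (C * 1) F := lipschitzOnWith_univ.1
    (hC.comp (lipschitzWith_clampRe I₁).lipschitzOnWith fun z _ => le_re_clampRe I₁ z)
  have hF1 : ∀ z, ‖F z - 1‖ ≤ ζ - 1 := fun z =>
    norm_LFunction_sub_one_le m hI (le_re_clampRe I₁ z)
  have hFre : ∀ z, |(F z).re - 1| ≤ ζ - 1 := fun z =>
    (Complex.abs_re_le_norm (F z - 1)).trans (hF1 z)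
  have hFim : ∀ z, |(F z).im| ≤ ζ - 1 := fun z => by
    simpa using (Complex.abs_im_le_norm (F z - 1)).trans (hF1 z)
  have hFpos : ∀ z, 0 < (F z).re := fun z => re_LFunction_pos m hg (le_re_clampRe I₁ z)
  have hFb : ∀ z, ‖F z‖ ≤ ζ := fun z => by
    have h := norm_add_le (F z - 1) 1
    rw [sub_add_cancel, norm_one] at h
    linarith [hF1 z]
  have hζ : 0 ≤ ζ := (norm_nonneg _).trans (hFb 0)
  obtain ⟨U, hUc, hU⟩ := exists_mild_solution hF hFb g
  let f : ℝ → EuclideanSpace ℝ (Fin d) → ℂ := fun s y => F (U s y)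
  have hf : Continuous (Function.uncurry f) := hF.continuous.comp hUc
  have hfb : ∀ s y, ‖f s y‖ ≤ ζ := fun s y => hFb _
  have hbound : ∀ t x, ‖U t x‖ ≤ ‖g‖ + ζ * max t 0 := fun t x => by
    rw [hU t x]
    exact (norm_add_le _ _).trans (add_le_add (norm_heatAverage_le g.norm_coe_le_norm _ _)
      (norm_duhamelIntegral_le_mul (le_max_right _ _) (fun s _ y => hfb s y) x))
  -- Upper bounds also come from here, with `φ` replaced by `-φ`.
  have hlower : ∀ (φ : ℂ →L[ℝ] ℝ) (a b : ℝ), (∀ y, a ≤ φ (g y)) → (∀ z, b ≤ φ (F z)) →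
      ∀ t x, b * max t 0 + a ≤ φ (U t x) := by
    intro φ a b ha hb t x
    rw [hU t x, map_add, add_comm]
    exact add_le_add (le_heatAverage φ g.continuous g.norm_coe_le_norm ha _ x)
      (mul_le_duhamelIntegral φ hf hfb (le_max_right _ _) (fun s _ y => hb _) x)
  -- Taking `b = 0` uses only `Re F > 0`. This is where the abscissa enters, and it shows that the
  -- clamp in `F` is inactive along `U`.
  have hUre : ∀ t x, I₁ ≤ (U t x).re := fun t x => by
    simpa using hlower Complex.reCLM I₁ 0 hgI₁ (fun z => (hFpos z).le) t x
  have hfL : ∀ s y, f s y = Lm (U s y) := fun s y => by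
    simp only [f, F, clampRe_of_le (hUre s y)]
  let u : ℝ → (EuclideanSpace ℝ (Fin d) →ᵇ ℂ) := fun t =>
    ofNormedAddCommGroup (U t) (hUc.uncurry_left t) _ (hbound t)
  have hu : ∀ t, 0 ≤ t → ∀ x, u t x = heatAverage t g x + duhamelIntegral f t x := by
    intro t ht x
    have := hU t x
    rwa [max_eq_left ht] at this
  have hsol : ∀ T : ℝ, 0 < T → IsDuhamelSolution m g T u := fun T hT =>
    { continuousOn_norm := fun t ht =>
        (continuousAt_of_mild hf hfb hu ht.1).continuousWithinAt
      continuousOn_joint := hUc.continuousOn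
      bounded := ⟨‖g‖ + ζ * T, fun t ht => by
        have hT0 := mul_nonneg hζ hT.le
        refine (norm_le (by positivity)).2 fun x => (hbound t x).trans ?_
        rw [max_eq_left ht.1]
        gcongr
        exact ht.2⟩
      away_from_pole := ⟨I₁ - 1, sub_pos.2 hI, fun t _ x => by
        have h1 : I₁ - 1 ≤ (u t x).re - 1 := sub_le_sub_right (hUre t x) 1
        linarith [le_abs_self ((u t x).re - 1), abs_nonneg (u t x).im]⟩
      initial := by
        ext x
        rw [hu 0 le_rfl, heatAverage_zero]
        simp [duhamelIntegral]
      duhamel := fun t ht x => by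
        rw [hu t ht.1.le, heatSemigroup_eq_heatAverage ht.1,
          integral_heatSemigroup_eq_duhamelIntegral (f := fun s y => Lm (u s y)) ht.1.le]
        congr 1
        exact duhamelIntegral_congr ht.1.le (fun s _ => funext fun y => hfL s y) x }
  refine ⟨u, hsol, fun T hT v hv => hv.eqOn hT (hsol T hT), fun hgu t ht => ?_,
    fun t ht x => ⟨⟨?_, ?_⟩, ?_, ?_⟩⟩
  · rcases (mem_Ici.1 ht).eq_or_lt with rfl | h0
    · exact continuousWithinAt_zero_of_mild hfb hgu hu
    · exact (continuousAt_of_mild hf hfb hu h0).continuousWithinAt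
  -- Two lower bounds for `Re F` are combined: positivity, and `1 - (ζ - 1)` from `|F - 1| ≤ ζ - 1`.
  · have := hlower Complex.reCLM I₁ (max 0 (2 - ζ)) hgI₁
      (fun z => max_le (hFpos z).le (by
        have := (abs_le.1 (hFre z)).1
        simp only [Complex.reCLM_apply]
        linarith)) t x
    rwa [max_eq_left ht] at this
  · have := hlower (-Complex.reCLM) (-S₁) (-ζ) (fun y => neg_le_neg (hgS₁ y))
      (fun z => neg_le_neg ((Complex.re_le_norm _).trans (hFb z))) t x
    rw [max_eq_left ht] at this
    have h2 : -ζ * t + -S₁ ≤ -(u t x).re := this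
    linarith
  · have := hlower Complex.imCLM I₂ (1 - ζ) hgI₂
      (fun z => by
        have := (abs_le.1 (hFim z)).1
        simp only [Complex.imCLM_apply]
        linarith) t x
    rwa [max_eq_left ht] at this
  · have := hlower (-Complex.imCLM) (-S₂) (-(ζ - 1)) (fun y => neg_le_neg (hgS₂ y))
      (fun z => neg_le_neg (abs_le.1 (hFim z)).2) t x
    rw [max_eq_left ht] at this
    have h2 : -(ζ - 1) * t + -S₂ ≤ -(u t x).im := this
    linarith
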